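/- Let $\gamma:[a,b]\to\mathbb{H}_+=\{\operatorname{Im} z>0\}$ be a $C^1$ curve with $\gamma'\neq 0$ on $[a,b]$, $a<b$, let $\Gamma$ be its image, let $|d\zeta|$ be the arc length measure (the image of $|\gamma'(t)|\,dt$ under $\gamma$), and $L^2(\Gamma)=L^2(\Gamma,|d\zeta|)$ (complex valued functions). Let $$(\mathcal{K}u)(\zeta)=\frac{1}{2\pi}\int_\Gamma\frac{i\,u(\tau)}{\zeta-\overline{\tau}}\,|d\tau| ,$$ let $\{e_n\}_{n\ge 1}$ be an orthonormal basis of $L^2(\Gamma)$ of eigenfunctions of $\mathcal{K}$, $\mathcal{K}e_n=\lambda_n e_n$ with $\lambda_n\in\mathbb{R}$, and put $f_n=(f,e_n)_{L^2(\Gamma)}=\int_\Gamma f\,\overline{e_n}\,|d\zeta|$ and $$H_+=\Big\{f\in L^2(\Gamma):\ \sum_{n\ge 1}\frac{|f_n|^2}{\lambda_n}<\infty\Big\},\qquad (f,g)_+=\sum_{n\ge 1}\frac{f_n\overline{g_n}}{\lambda_n}\quad(f,g\in H_+).$$ (If some $\lambda_n=0$, membership in $H_+$ is understood to require $f_n=0$,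 and the corresponding terms are $0$.) Let $H^2=H^2(\mathbb{H}_+)$ be the space of analytic $F$ on $\mathbb{H}_+$ with $\sup_{y>0}\|F(\cdot+iy)\|_{L^2(\mathbb{R})}<\infty$, with the inner product $(F,G)_{H^2}=\int_{\mathbb{R}}F(x)\overline{G(x)}\,dx$ of boundary values, where the boundary value of $F$ is the limit of $F(\cdot+iy)$ in $L^2(\mathbb{R})$ as $y\downarrow 0$. Then a function $f\in L^2(\Gamma)$ belongs to $H_+$ if and only if there is an $F\in H^2$ with $F=f$ almost everywhere on $\Gamma$, and such an $F$ is unique. The restriction to $\Gamma$ of every function in $H^2$ belongs to $H_+$. Moreover, if $f,g\in H_+$ have the extensions $F,G\in H^2$, then $F$ and $G$ have boundary values in $L^2(\mathbb{R})$, the series for $(f,g)_+$ converges, and $$(f,g)_+=(F,G)_{H^2}.$$ -/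

import Mathlib

open MeasureTheory Filter Topology
open scoped ComplexConjugate ENNReal

noncomputable section

namespace HardyCurve

/-- The restriction of `γ` to `[a, b]` is a compact smooth (regular `C¹`) curve that lies in the
open upper half-plane. Simplicity is not needed, so it is not required. -/
structure IsSmoothCurve (γ : ℝ → ℂ) (a b : ℝ) : Prop where
  lt : a < b
  contDiffOn : ContDiffOn ℝ 1 γ (Set.Icc a b)
  deriv_ne_zero : ∀ t ∈ Set.Icc a b, derivWithin γ (Set.Icc a b) t ≠ 0
  im_pos : ∀ t ∈ Set.Icc a b, 0 < (γ t).im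

/-- The arc length measure `|dζ|` of the curve: the image under `γ` of `|γ'(t)| dt` on `[a, b]`. -/
def arcLength (γ : ℝ → ℂ) (a b : ℝ) : Measure ℂ :=
  Measure.map γ ((volume.restrict (Set.Icc a b)).withDensity
    fun t => ‖derivWithin γ (Set.Icc a b) t‖ₑ)

/-- The Hilbert space `L²(Γ) = L²(Γ, |dζ|)` of complex valued functions. -/
abbrev L2Curve (γ : ℝ → ℂ) (a b : ℝ) : Type := Lp ℂ 2 (arcLength γ a b)

/-- The integral operator
`(𝒦 u)(ζ) = (1 / 2π) ∫_Γ i u(τ) / (ζ - conj τ) |dτ|`. -/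
def curveOp (γ : ℝ → ℂ) (a b : ℝ) (u : ℂ → ℂ) (ζ : ℂ) : ℂ :=
  1 / (2 * (Real.pi : ℂ)) * ∫ τ, Complex.I * u τ / (ζ - conj τ) ∂(arcLength γ a b)

/-- `e` is an orthonormal eigenbasis of `𝒦` on `L²(Γ)`, with eigenvalues `lam`. (Orthonormality
and completeness are part of the type `HilbertBasis`.) -/
def IsEigenbasis {γ : ℝ → ℂ} {a b : ℝ} (e : HilbertBasis ℕ ℂ (L2Curve γ a b))
    (lam : ℕ → ℝ) : Prop :=
  ∀ n, curveOp γ a b (e n) =ᵐ[arcLength γ a b] fun ζ => (lam n : ℂ) * e n ζ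

/-- The coefficient `f_n = (f, e_n)_{L²(Γ)} = ∫_Γ f conj(e_n) |dζ|`. (Mathlib's inner product is
conjugate linear in its first argument.) -/
def coeff {γ : ℝ → ℂ} {a b : ℝ} (e : HilbertBasis ℕ ℂ (L2Curve γ a b))
    (f : L2Curve γ a b) (n : ℕ) : ℂ :=
  inner ℂ (e n) f

/-- The space `H₊` of all `f ∈ L²(Γ)` with `∑ |f_n|² / λ_n < ∞`. The series is taken in `[0, ∞]`,
so that a term with `λ_n = 0` is `∞` if `f_n ≠ 0`, and `0` if `f_n = 0`. -/
def HPlus {γ : ℝ → ℂ} {a b : ℝ} (e : HilbertBasis ℕ ℂ (L2Curve γ a b))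
    (lam : ℕ → ℝ) : Set (L2Curve γ a b) :=
  {f | ∑' n, ‖coeff e f n‖ₑ ^ 2 / ENNReal.ofReal (lam n) < ∞}

/-- `F` belongs to the Hardy space `H²` of the upper half-plane: it is analytic there and
`sup_{y > 0} ‖F(· + iy)‖_{L²(ℝ)} < ∞`. The values of `F` outside the open upper half-plane
are irrelevant. -/
def MemHardy (F : ℂ → ℂ) : Prop :=
  DifferentiableOn ℂ F {z : ℂ | 0 < z.im} ∧
    ⨆ y ∈ Set.Ioi (0 : ℝ),
      eLpNorm (fun x : ℝ => F ((x : ℂ) + (y : ℂ) * Complex.I)) 2 volume < ∞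

/-- `φ ∈ L²(ℝ)` is the boundary value of `F`: `F(· + iy) → φ` in `L²(ℝ)` as `y ↓ 0`. -/
def IsBoundaryValue (F : ℂ → ℂ) (φ : Lp ℂ 2 (volume : Measure ℝ)) : Prop :=
  Tendsto (fun y : ℝ => eLpNorm
      (fun x : ℝ => F ((x : ℂ) + (y : ℂ) * Complex.I) - φ x) 2 volume)
    (𝓝[>] 0) (𝓝 0)

/-- `F` is an extension of `f ∈ L²(Γ)` to a function in `H²` of the upper half-plane. -/
def IsHardyExtension {γ : ℝ → ℂ} {a b : ℝ} (F : ℂ → ℂ) (f : L2Curve γ a b) : Prop :=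
  MemHardy F ∧ F =ᵐ[arcLength γ a b] f

end HardyCurve

end

noncomputable section

namespace HardyCurve

/-! Let `k_ζ` be the boundary value of the Szegő kernel (`szegoLp`), and let R send φ ∈ L²(ℝ) to the
function ζ ↦ ⟪k_ζ, φ⟫ on Γ (`restr`). Its adjoint R* is u ↦ ∫ u(τ) k_τ |dτ| (`synth`). Since ⟪k_ζ,
k_τ⟫ is exactly the kernel of 𝒦, the operator factors as 𝒦 = R R* (`restr_synth_ae_eq`). Hence the
vectors v_n = R* e_n are orthogonal with ‖v_n‖² = λ_n, and (Rφ)_n = ⟪v_n, φ⟫.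

Bessel's inequality for the v_n then says that every Rφ lies in H₊ (`restr_mem_HPlus`). Conversely,
for f ∈ H₊ the orthogonal series ∑ (f_n / λ_n) v_n converges in H², and R maps its sum to f
(`exists_hasSum_of_mem_HPlus`). By the identity theorem R is injective on H² (`restr_injOn`), so
this series is the boundary value of any given extension F; pairing it term by term with the
boundary value of G gives the inner product formula.

The Hardy space facts come from Cauchy's theorem in strips. The inner product of two slices of F
depends only on the sum of their heights, so the squared distance of two slices is a second
difference of a bounded midpoint convex function; this yields boundary values
(`MemHardy.exists_tendsto_sliceLp`). The reproducing formula (`MemHardy.eq_inner`) follows by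
subtracting from F a multiple of a Szegő kernel that cancels its value at z. Closedness of H² in
L²(ℝ) (`isClosed_hardySpace`) keeps R*u and the sums of the series in H². -/

/-! ### Cauchy's theorem in strips -/

/-- The function `x ↦ F (x + i y)` on the real line. -/
def slice (F : ℂ → ℂ) (y : ℝ) (x : ℝ) : ℂ := F ((x : ℂ) + (y : ℂ) * Complex.I)

/-- The open upper half-plane. -/
abbrev upperHalf : Set ℂ := {z : ℂ | 0 < z.im}

lemma isOpen_upperHalf : IsOpen upperHalf := isOpen_lt continuous_const Complex.continuous_im

/-- Cauchy's theorem for a horizontal strip. -/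
lemma integral_slice_eq {G : ℂ → ℂ} {a b : ℝ} (hab : a ≤ b)
    (hG : DifferentiableOn ℂ G {z | z.im ∈ Set.Icc a b})
    (ha : Integrable (slice G a)) (hb : Integrable (slice G b))
    (hs : Integrable (fun p : ℝ × ℝ => slice G p.2 p.1)
      (volume.prod (volume.restrict (Set.Icc a b)))) :
    ∫ x, slice G a x = ∫ x, slice G b x := by
  set v : ℝ → ℝ := fun x => ∫ y in Set.Icc a b, ‖slice G y x‖ with hv
  have hvi : Integrable v := hs.integral_norm_prod_left
  have hside : ∀ x : ℝ, ‖Complex.I • ∫ y in a..b, slice G y x‖ ≤ v x := fun x => by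
    rw [norm_smul, Complex.norm_I, one_mul, hv]
    refine (intervalIntegral.norm_integral_le_integral_norm hab).trans_eq ?_
    rw [intervalIntegral.integral_of_le hab]
    exact integral_Icc_eq_integral_Ioc.symm
  have key : ∀ R : ℝ, ‖(∫ x in (-R)..R, slice G a x) - ∫ x in (-R)..R, slice G b x‖
      ≤ v R + v (-R) := fun R => by
    have h := Complex.integral_boundary_rect_eq_zero_of_differentiableOn G
      (⟨-R, a⟩ : ℂ) ⟨R, b⟩ (hG.mono fun z hz => by
        have := hz.2
        simpa [Set.uIcc_of_le hab] using this)
    have e : (∫ x in (-R)..R, slice G a x) - ∫ x in (-R)..R, slice G b x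
        = (Complex.I • ∫ y in a..b, slice G y (-R)) - Complex.I • ∫ y in a..b, slice G y R := by
      rw [eq_sub_iff_add_eq, ← sub_eq_zero]
      exact h
    rw [e, add_comm]
    exact (norm_sub_le _ _).trans (add_le_add (hside _) (hside _))
  -- The vertical sides of the rectangle over `[-R, R]` contribute at most `v R + v (-R)`, which is
  -- integrable in `R` by Fubini. If the two integrals differed, this quantity would stay above a
  -- positive constant for all large `R`, which is impossible. No pointwise decay of `G` is needed.
  by_contra hne
  have hpos : 0 < ‖(∫ x, slice G a x) - ∫ x, slice G b x‖ := norm_pos_iff.2 (sub_ne_zero.2 hne)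
  have hlim : Tendsto (fun R : ℝ =>
      ‖(∫ x in (-R)..R, slice G a x) - ∫ x in (-R)..R, slice G b x‖) atTop
      (𝓝 ‖(∫ x, slice G a x) - ∫ x, slice G b x‖) :=
    ((intervalIntegral_tendsto_integral ha tendsto_neg_atTop_atBot tendsto_id).sub
      (intervalIntegral_tendsto_integral hb tendsto_neg_atTop_atBot tendsto_id)).norm
  set c := ‖(∫ x, slice G a x) - ∫ x, slice G b x‖ / 2 with hc
  have hc0 : 0 < c := half_pos hpos
  obtain ⟨R₀, hR₀⟩ := eventually_atTop.1 (hlim.eventually (lt_mem_nhds (half_lt_self hpos)))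
  have hi : Integrable (fun R => v R + v (-R)) := hvi.add hvi.comp_neg
  have hconst : IntegrableOn (fun _ : ℝ => c) (Set.Ioi R₀) := by
    refine hi.integrableOn.mono' aestronglyMeasurable_const ?_
    filter_upwards [ae_restrict_mem measurableSet_Ioi] with R hR
    rw [Real.norm_of_nonneg hc0.le]
    exact (hR₀ R (le_of_lt hR)).le.trans (key R)
  rw [integrableOn_const_iff] at hconst
  simp [hc0.ne'] at hconst

lemma continuous_line (y : ℝ) : Continuous fun x : ℝ => (x : ℂ) + (y : ℂ) * Complex.I := by
  fun_prop

/-! ### Slices of Hardy functions -/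

namespace MemHardy

variable {F G : ℂ → ℂ}

lemma continuousOn (hF : MemHardy F) : ContinuousOn F upperHalf := hF.1.continuousOn

lemma continuous_slice (hF : MemHardy F) {y : ℝ} (hy : 0 < y) : Continuous (slice F y) :=
  hF.continuousOn.comp_continuous (continuous_line y) fun x => by simpa using hy

lemma exists_bound (hF : MemHardy F) :
    ∃ C : ℝ≥0∞, C < ∞ ∧ ∀ y, 0 < y → eLpNorm (slice F y) 2 volume ≤ C :=
  ⟨_, hF.2, fun y hy => le_iSup₂ (f := fun (y : ℝ) (_ : y ∈ Set.Ioi (0 : ℝ)) =>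
    eLpNorm (fun x : ℝ => F ((x : ℂ) + (y : ℂ) * Complex.I)) 2 volume) y hy⟩

lemma of_bound (hd : DifferentiableOn ℂ F upperHalf) {C : ℝ≥0∞} (hC : C < ∞)
    (h : ∀ y, 0 < y → eLpNorm (slice F y) 2 volume ≤ C) : MemHardy F :=
  ⟨hd, (iSup₂_le fun y hy => h y hy).trans_lt hC⟩

lemma memLp_slice (hF : MemHardy F) {y : ℝ} (hy : 0 < y) : MemLp (slice F y) 2 volume :=
  let ⟨_, hC, h⟩ := hF.exists_bound
  ⟨(hF.continuous_slice hy).aestronglyMeasurable, (h y hy).trans_lt hC⟩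

lemma add (hF : MemHardy F) (hG : MemHardy G) : MemHardy (F + G) := by
  obtain ⟨C, hC, h⟩ := hF.exists_bound
  obtain ⟨D, hD, k⟩ := hG.exists_bound
  refine of_bound (hF.1.add hG.1) (ENNReal.add_lt_top.2 ⟨hC, hD⟩) fun y hy => ?_
  exact (eLpNorm_add_le (hF.memLp_slice hy).1 (hG.memLp_slice hy).1 (by norm_num)).trans
    (add_le_add (h y hy) (k y hy))

lemma const_smul (hF : MemHardy F) (c : ℂ) : MemHardy (c • F) := by
  obtain ⟨C, hC, h⟩ := hF.exists_bound
  refine of_bound (hF.1.const_smul c) (C := ‖c‖ₑ * C) (ENNReal.mul_lt_top (by simp) hC)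
    fun y hy => ?_
  exact (eLpNorm_const_smul c (slice F y) 2 volume).trans_le (mul_le_mul_right (h y hy) _)

lemma sub (hF : MemHardy F) (hG : MemHardy G) : MemHardy (F - G) := by
  have := hF.add (hG.const_smul (-1))
  rwa [neg_one_smul, ← sub_eq_add_neg] at this

/-- A Hardy function is square integrable over (reparametrised) strips. -/
lemma memLp_strip (hF : MemHardy F) {a b : ℝ} {g : ℝ → ℝ} (hg : Continuous g)
    (hpos : ∀ y ∈ Set.Icc a b, 0 < g y) :
    MemLp (fun p : ℝ × ℝ => slice F (g p.2) p.1) 2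
      (volume.prod (volume.restrict (Set.Icc a b))) := by
  have hmeas : AEStronglyMeasurable (fun p : ℝ × ℝ => slice F (g p.2) p.1)
      ((volume : Measure ℝ).prod (volume.restrict (Set.Icc a b))) := by
    rw [← Measure.restrict_univ (μ := (volume : Measure ℝ)), Measure.restrict_restrict
      measurableSet_Icc, Set.inter_univ, Measure.prod_restrict]
    refine ContinuousOn.aestronglyMeasurable ?_ (MeasurableSet.univ.prod measurableSet_Icc)
    refine hF.continuousOn.comp (by fun_prop) fun p hp => ?_
    simpa using hpos p.2 hp.2
  obtain ⟨C, hC, h⟩ := hF.exists_bound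
  refine ⟨hmeas, ?_⟩
  rw [eLpNorm_lt_top_iff_lintegral_rpow_enorm_lt_top two_ne_zero ENNReal.ofNat_ne_top,
    lintegral_prod_symm _ (hmeas.enorm.pow_const _)]
  have hb : ∀ y ∈ Set.Icc a b, ∫⁻ x, ‖slice F (g y) x‖ₑ ^ (2 : ℝ≥0∞).toReal ≤ C ^ (2 : ℝ) :=
    fun y hy => by
      have h1 := h _ (hpos y hy)
      rw [eLpNorm_eq_lintegral_rpow_enorm_toReal two_ne_zero ENNReal.ofNat_ne_top] at h1
      have h2 := ENNReal.rpow_le_rpow h1 (zero_le_two (α := ℝ))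
      rw [← ENNReal.rpow_mul] at h2
      simpa using h2
  refine (setLIntegral_mono' measurableSet_Icc hb).trans_lt ?_
  rw [setLIntegral_const]
  exact ENNReal.mul_lt_top (ENNReal.rpow_lt_top_of_nonneg zero_le_two hC.ne) (by simp)

/-- The inner product of two slices depends only on the sum of the heights. -/
lemma integral_slice_mul_conj_shift (hF : MemHardy F) (hG : MemHardy G) {y₁ y₂ t : ℝ}
    (h₂ : 0 < y₂) (ht : 0 ≤ t) (hty : t < y₁) :
    ∫ x, slice F y₂ x * conj (slice G y₁ x)
      = ∫ x, slice F (y₂ + t) x * conj (slice G (y₁ - t) x) := by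
  -- The reflection `w ↦ conj (G (conj w + i y₁))` is again analytic, and its height falls as that
  -- of `w` rises. So the slice of `H` at height `s` pairs `F` at `y₂ + s` with `G` at `y₁ - s`, and
  -- Cauchy's theorem applies between `s = 0` and `s = t`.
  set H : ℂ → ℂ := fun w => F (w + y₂ * Complex.I) * conj (G (conj w + y₁ * Complex.I)) with hH
  have hsl : ∀ s x : ℝ, slice H s x = slice F (y₂ + s) x * conj (slice G (y₁ - s) x) := by
    intro s x
    simp only [slice, hH]
    congr 2
    · push_cast; ring
    · congr 1
      simp only [map_add, map_mul, Complex.conj_ofReal, Complex.conj_I]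
      push_cast; ring
  have hint : ∀ s, 0 ≤ s → s ≤ t → Integrable (slice H s) := fun s hs hst => by
    have hE : slice H s = slice F (y₂ + s) * fun x => conj (slice G (y₁ - s) x) :=
      funext (hsl s)
    rw [hE]
    exact (hF.memLp_slice (by linarith)).integrable_mul
      ((hG.memLp_slice (by linarith)).star)
  have hd : DifferentiableOn ℂ H {z | z.im ∈ Set.Icc 0 t} := by
    intro z hz
    refine DifferentiableAt.differentiableWithinAt ?_
    have d1 : DifferentiableAt ℂ (fun w => F (w + y₂ * Complex.I)) z := by
      refine DifferentiableAt.comp (g := F) z (hF.1.differentiableAt (isOpen_upperHalf.mem_nhds ?_))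
        (by fun_prop)
      have := hz.1
      simp; linarith
    have d2 : DifferentiableAt ℂ (fun w => conj (G (conj w + y₁ * Complex.I))) z := by
      have d3 : DifferentiableAt ℂ (fun w => G (w + y₁ * Complex.I)) (conj z) := by
        refine DifferentiableAt.comp (g := G) (conj z)
          (hG.1.differentiableAt (isOpen_upperHalf.mem_nhds ?_)) (by fun_prop)
        have := hz.2
        simp; linarith
      exact differentiableAt_conj_conj_iff.2 d3
    exact d1.mul d2
  have hs : Integrable (fun p : ℝ × ℝ => slice H p.2 p.1)
      (volume.prod (volume.restrict (Set.Icc 0 t))) := by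
    have e : (fun p : ℝ × ℝ => slice H p.2 p.1) = (fun p : ℝ × ℝ => slice F (y₂ + p.2) p.1) *
        (fun p : ℝ × ℝ => conj (slice G (y₁ - p.2) p.1)) := funext fun p => hsl _ _
    rw [e]
    refine (hF.memLp_strip (g := fun y => y₂ + y) (by fun_prop) fun y hy => ?_).integrable_mul
      (hG.memLp_strip (g := fun y => y₁ - y) (by fun_prop) fun y hy => ?_).star
    · linarith [hy.1]
    · linarith [hy.2]
  have := integral_slice_eq ht hd (hint 0 le_rfl ht) (hint t ht le_rfl) hs
  simpa [hsl] using this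

end MemHardy

/-! ### Existence of boundary values -/

/-- By midpoint convexity, increments along an arithmetic progression never decrease. A single
increase from `s` to `s'` would therefore force at least linear growth along `s + k (s' - s)`,
against the upper bound. Continuity is not needed. -/
lemma antitoneOn_of_midpoint_convex_of_bounded {N : ℝ → ℝ} {C : ℝ}
    (hmid : ∀ x y, 0 < x → 0 < y → 2 * N ((x + y) / 2) ≤ N x + N y)
    (hC : ∀ x, 0 < x → N x ≤ C) : AntitoneOn N (Set.Ioi 0) := by
  intro s hs s' hs' hss'
  by_contra! hlt
  have hs0 : 0 < s := hs
  have hd : 0 ≤ s' - s := by linarith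
  have hp : ∀ k : ℕ, 0 < s + k * (s' - s) := fun k => by positivity
  have step : ∀ k : ℕ, N s' - N s ≤ N (s + (k + 1 : ℕ) * (s' - s)) - N (s + k * (s' - s)) := by
    intro k
    induction k with
    | zero => simp
    | succ k ih =>
      have := hmid _ _ (hp (k + 2)) (hp k)
      have e : (s + (k + 2 : ℕ) * (s' - s) + (s + k * (s' - s))) / 2
          = s + (k + 1 : ℕ) * (s' - s) := by push_cast; ring
      rw [e] at this
      have e2 : k + 1 + 1 = k + 2 := rfl
      rw [e2]
      linarith
  have lin : ∀ k : ℕ, N s + k * (N s' - N s) ≤ N (s + k * (s' - s)) := by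
    intro k
    induction k with
    | zero => simp
    | succ k ih =>
      have := step k
      push_cast at this ⊢
      linarith
  obtain ⟨k, hk⟩ := exists_nat_gt ((C - N s) / (N s' - N s))
  rw [div_lt_iff₀ (by linarith)] at hk
  linarith [lin k, hC _ (hp k)]

lemma inner_self_eq_norm_sq_complex {E : Type*} [NormedAddCommGroup E] [InnerProductSpace ℂ E]
    (x : E) : inner ℂ x x = (‖x‖ : ℂ) ^ 2 := by
  simp

lemma inner_toLp {α : Type*} [MeasurableSpace α] {μ : Measure α} {f g : α → ℂ}
    (hf : MemLp f 2 μ) (hg : MemLp g 2 μ) :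
    inner ℂ (hf.toLp f) (hg.toLp g) = ∫ x, g x * conj (f x) ∂μ := by
  rw [L2.inner_def]
  refine integral_congr_ae ?_
  filter_upwards [hf.coeFn_toLp, hg.coeFn_toLp] with x h1 h2
  rw [h1, h2]
  rfl

open Classical in
/-- The slice of `F` at height `y` as an element of `L²(ℝ)`. -/
def sliceLp (F : ℂ → ℂ) (y : ℝ) : Lp ℂ 2 (volume : Measure ℝ) :=
  if h : MemLp (slice F y) 2 volume then h.toLp else 0

namespace MemHardy

variable {F G : ℂ → ℂ}

lemma sliceLp_eq (hF : MemHardy F) {y : ℝ} (hy : 0 < y) :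
    sliceLp F y = (hF.memLp_slice hy).toLp := dif_pos _

lemma coeFn_sliceLp (hF : MemHardy F) {y : ℝ} (hy : 0 < y) :
    sliceLp F y =ᵐ[volume] slice F y := by
  rw [hF.sliceLp_eq hy]
  exact MemLp.coeFn_toLp _

lemma sliceLp_sub (hF : MemHardy F) (hG : MemHardy G) {y : ℝ} (hy : 0 < y) :
    sliceLp (F - G) y = sliceLp F y - sliceLp G y := by
  rw [hF.sliceLp_eq hy, hG.sliceLp_eq hy, (hF.sub hG).sliceLp_eq hy]
  rfl

lemma sliceLp_add (hF : MemHardy F) (hG : MemHardy G) {y : ℝ} (hy : 0 < y) :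
    sliceLp (F + G) y = sliceLp F y + sliceLp G y := by
  rw [hF.sliceLp_eq hy, hG.sliceLp_eq hy, (hF.add hG).sliceLp_eq hy]
  rfl

lemma sliceLp_const_smul (hF : MemHardy F) (c : ℂ) {y : ℝ} (hy : 0 < y) :
    sliceLp (c • F) y = c • sliceLp F y := by
  rw [hF.sliceLp_eq hy, (hF.const_smul c).sliceLp_eq hy]
  rfl

/-- Moving half of the height difference from one factor to the other brings both slices to the mean
height. -/
lemma inner_sliceLp (hF : MemHardy F) {y₁ y₂ : ℝ} (h₁ : 0 < y₁) (h₂ : 0 < y₂) :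
    inner ℂ (sliceLp F y₁) (sliceLp F y₂) = (‖sliceLp F ((y₁ + y₂) / 2)‖ : ℂ) ^ 2 := by
  have main : ∀ {y₁ y₂ : ℝ}, 0 < y₁ → 0 < y₂ → y₂ ≤ y₁ →
      inner ℂ (sliceLp F y₁) (sliceLp F y₂) = (‖sliceLp F ((y₁ + y₂) / 2)‖ : ℂ) ^ 2 := by
    intro y₁ y₂ h₁ h₂ hle
    have hm : 0 < (y₁ + y₂) / 2 := by linarith
    rw [← inner_self_eq_norm_sq_complex, hF.sliceLp_eq h₁, hF.sliceLp_eq h₂, hF.sliceLp_eq hm,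
      inner_toLp, inner_toLp, hF.integral_slice_mul_conj_shift hF h₂ (t := (y₁ - y₂) / 2)
        (by linarith) (by linarith)]
    have e1 : y₂ + (y₁ - y₂) / 2 = (y₁ + y₂) / 2 := by ring
    have e2 : y₁ - (y₁ - y₂) / 2 = (y₁ + y₂) / 2 := by ring
    rw [e1, e2]
  rcases le_total y₂ y₁ with h | h
  · exact main h₁ h₂ h
  · rw [← inner_conj_symm, main h₂ h₁ h, add_comm y₂]
    simp

/-- This identity serves twice: its nonnegativity is midpoint convexity of the squared norm in the
height, and once the norms converge it makes the slices a Cauchy family. -/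
lemma norm_sliceLp_sub_sq (hF : MemHardy F) {y₁ y₂ : ℝ} (h₁ : 0 < y₁) (h₂ : 0 < y₂) :
    ‖sliceLp F y₁ - sliceLp F y₂‖ ^ 2
      = ‖sliceLp F y₁‖ ^ 2 + ‖sliceLp F y₂‖ ^ 2 - 2 * ‖sliceLp F ((y₁ + y₂) / 2)‖ ^ 2 := by
  rw [norm_sub_sq (𝕜 := ℂ), hF.inner_sliceLp h₁ h₂, ← Complex.ofReal_pow]
  simp only [RCLike.re_to_complex, Complex.ofReal_re]
  ring

lemma exists_norm_sliceLp_le (hF : MemHardy F) : ∃ C, ∀ y, 0 < y → ‖sliceLp F y‖ ≤ C := by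
  obtain ⟨C, hC, h⟩ := hF.exists_bound
  refine ⟨C.toReal, fun y hy => ?_⟩
  rw [hF.sliceLp_eq hy, Lp.norm_toLp]
  exact ENNReal.toReal_mono hC.ne (h y hy)

lemma antitoneOn_norm_sliceLp_sq (hF : MemHardy F) :
    AntitoneOn (fun y => ‖sliceLp F y‖ ^ 2) (Set.Ioi 0) := by
  obtain ⟨C, hC⟩ := hF.exists_norm_sliceLp_le
  refine antitoneOn_of_midpoint_convex_of_bounded (C := C ^ 2) (fun x y hx hy => ?_) fun x hx =>
    pow_le_pow_left₀ (norm_nonneg _) (hC x hx) 2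
  have := hF.norm_sliceLp_sub_sq hx hy
  have h0 : 0 ≤ ‖sliceLp F x - sliceLp F y‖ ^ 2 := by positivity
  linarith

/-- The slices of a Hardy function converge in `L²(ℝ)`. -/
lemma exists_tendsto_sliceLp (hF : MemHardy F) :
    ∃ φ, Tendsto (sliceLp F) (𝓝[>] 0) (𝓝 φ) := by
  obtain ⟨C, hC⟩ := hF.exists_norm_sliceLp_le
  obtain ⟨l, hl⟩ : ∃ l, Tendsto (fun y => ‖sliceLp F y‖ ^ 2) (𝓝[>] 0) (𝓝 l) :=
    ⟨_, hF.antitoneOn_norm_sliceLp_sq.tendsto_nhdsGT (by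
      refine ⟨C ^ 2, ?_⟩
      rintro _ ⟨y, hy, rfl⟩
      exact pow_le_pow_left₀ (norm_nonneg _) (hC y hy) 2)⟩
  have hcau : Cauchy (map (sliceLp F) (𝓝[>] 0)) := by
    rw [cauchy_map_iff]
    refine ⟨inferInstance, ?_⟩
    rw [Metric.uniformity_eq_comap_nhds_zero, tendsto_comap_iff]
    have hpos : ∀ᶠ p : ℝ × ℝ in 𝓝[>] 0 ×ˢ 𝓝[>] 0, 0 < p.1 ∧ 0 < p.2 :=
      (eventually_mem_nhdsWithin.prod_mk eventually_mem_nhdsWithin)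
    -- The mean height also tends to `0` from above, so all three squared norms have the same limit
    -- `l` and the second difference tends to `l + l - 2 * l = 0`.
    have hmid : Tendsto (fun p : ℝ × ℝ => (p.1 + p.2) / 2) (𝓝[>] 0 ×ˢ 𝓝[>] 0) (𝓝[>] 0) := by
      refine tendsto_nhdsWithin_iff.2 ⟨?_, hpos.mono fun p hp => ?_⟩
      · have h1 : Tendsto (Prod.fst : ℝ × ℝ → ℝ) (𝓝[>] 0 ×ˢ 𝓝[>] 0) (𝓝 0) :=
          tendsto_fst.mono_right nhdsWithin_le_nhds
        have h2 : Tendsto (Prod.snd : ℝ × ℝ → ℝ) (𝓝[>] 0 ×ˢ 𝓝[>] 0) (𝓝 0) :=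
          tendsto_snd.mono_right nhdsWithin_le_nhds
        simpa using (h1.add h2).div_const 2
      · have := hp.1; have := hp.2
        simp only [Set.mem_Ioi]; linarith
    have hlim := ((hl.comp tendsto_fst).add (hl.comp tendsto_snd)).sub ((hl.comp hmid).const_mul 2)
    have hzero : l + l - 2 * l = 0 := by ring
    rw [hzero] at hlim
    have hsq : Tendsto (fun p : ℝ × ℝ => ‖sliceLp F p.1 - sliceLp F p.2‖ ^ 2)
        (𝓝[>] 0 ×ˢ 𝓝[>] 0) (𝓝 0) :=
      hlim.congr' (hpos.mono fun p hp => (hF.norm_sliceLp_sub_sq hp.1 hp.2).symm)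
    have := hsq.sqrt
    simpa [Function.comp_def, dist_eq_norm] using this
  exact CompleteSpace.complete hcau

lemma isBoundaryValue_iff (hF : MemHardy F) {φ : Lp ℂ 2 (volume : Measure ℝ)} :
    IsBoundaryValue F φ ↔ Tendsto (sliceLp F) (𝓝[>] 0) (𝓝 φ) := by
  rw [tendsto_iff_edist_tendsto_0]
  refine tendsto_congr' ?_
  filter_upwards [self_mem_nhdsWithin] with y hy
  rw [Lp.edist_def]
  refine eLpNorm_congr_ae ?_
  filter_upwards [hF.coeFn_sliceLp hy] with x hx
  simp [hx, slice]

lemma norm_sliceLp_le (hF : MemHardy F) {φ : Lp ℂ 2 (volume : Measure ℝ)}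
    (hφ : Tendsto (sliceLp F) (𝓝[>] 0) (𝓝 φ)) {y : ℝ} (hy : 0 < y) :
    ‖sliceLp F y‖ ≤ ‖φ‖ := by
  refine ge_of_tendsto hφ.norm ?_
  filter_upwards [Ioo_mem_nhdsGT hy] with s hs
  exact (pow_le_pow_iff_left₀ (norm_nonneg _) (norm_nonneg _) two_ne_zero).1
    (hF.antitoneOn_norm_sliceLp_sq hs.1 hy hs.2.le)

end MemHardy

/-! ### The Szegő kernel and the Cauchy formula on horizontal lines -/

lemma integrable_inv_sq_add_sq (c : ℝ) {d : ℝ} (hd : d ≠ 0) :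
    Integrable fun x : ℝ => ((x - c) ^ 2 + d ^ 2)⁻¹ := by
  have h := ((integrable_inv_one_add_sq.comp_div hd).comp_sub_right c).const_mul (d ^ 2)⁻¹
  refine h.congr (Eventually.of_forall fun x => ?_)
  field_simp
  ring

lemma integral_inv_sq_add_sq (c : ℝ) {d : ℝ} (hd : d ≠ 0) :
    ∫ x : ℝ, ((x - c) ^ 2 + d ^ 2)⁻¹ = Real.pi / |d| := by
  have e : (fun x : ℝ => ((x - c) ^ 2 + d ^ 2)⁻¹)
      = fun x => (d ^ 2)⁻¹ * (1 + ((x - c) / d) ^ 2)⁻¹ := funext fun x => by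
    field_simp
    ring
  rw [e, integral_const_mul, integral_sub_right_eq_self (fun x => (1 + (x / d) ^ 2)⁻¹) c,
    Measure.integral_comp_div (fun x => (1 + x ^ 2)⁻¹), integral_univ_inv_one_add_sq, smul_eq_mul,
    ← sq_abs d]
  have : |d| ≠ 0 := abs_ne_zero.2 hd
  field_simp

lemma sub_ne_zero_of_im_ne_zero {c : ℂ} (hc : c.im ≠ 0) (x : ℝ) : (x : ℂ) - c ≠ 0 := fun h => by
  have := congrArg Complex.im h
  simp at this
  exact hc this

lemma inv_sub_mul_conj (c : ℂ) (x : ℝ) :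
    ((x : ℂ) - c)⁻¹ * conj ((x : ℂ) - c)⁻¹ = (((x - c.re) ^ 2 + c.im ^ 2)⁻¹ : ℝ) := by
  rw [map_inv₀, ← mul_inv, Complex.mul_conj, Complex.normSq_apply]
  push_cast
  simp
  ring

lemma memLp_inv_sub {c : ℂ} (hc : c.im ≠ 0) :
    MemLp (fun x : ℝ => ((x : ℂ) - c)⁻¹) 2 volume := by
  have hcont : Continuous fun x : ℝ => ((x : ℂ) - c)⁻¹ :=
    Continuous.inv₀ (by fun_prop) (sub_ne_zero_of_im_ne_zero hc)
  rw [memLp_two_iff_integrable_sq_norm hcont.aestronglyMeasurable]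
  refine (integrable_inv_sq_add_sq c.re hc).congr (Eventually.of_forall fun x => ?_)
  have h := inv_sub_mul_conj c x
  rw [Complex.mul_conj, Complex.normSq_eq_norm_sq] at h
  exact (Complex.ofReal_injective h).symm

lemma norm_toLp_inv_sub_sq {c : ℂ} (hc : c.im ≠ 0) :
    ‖(memLp_inv_sub hc).toLp‖ ^ 2 = Real.pi / |c.im| := by
  have h := inner_self_eq_norm_sq_complex ((memLp_inv_sub hc).toLp)
  rw [inner_toLp] at h
  simp only [inv_sub_mul_conj] at h
  rw [integral_complex_ofReal, integral_inv_sq_add_sq _ hc] at h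
  have h' : ((Real.pi / |c.im| : ℝ) : ℂ) = ((‖(memLp_inv_sub hc).toLp‖ ^ 2 : ℝ) : ℂ) := by
    rw [h]; push_cast; rfl
  exact (Complex.ofReal_injective h').symm

/-- The reproducing (Szegő) kernel of the Hardy space of the upper half-plane. -/
def szego (w z : ℂ) : ℂ := Complex.I / (2 * (Real.pi : ℂ) * (z - conj w))

lemma szego_eq (w z : ℂ) : szego w z = Complex.I / (2 * (Real.pi : ℂ)) * (z - conj w)⁻¹ := by
  rw [szego, ← div_div, div_eq_mul_inv]

/-- The pole `conj w` lies below the real axis, so raising `x` to `x + i y` only increases the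
distance to it; the values on the real line dominate every slice. -/
lemma memHardy_szego {w : ℂ} (hw : 0 < w.im) : MemHardy (szego w) := by
  have hc : (conj w).im ≠ 0 := by simpa using hw.ne'
  refine MemHardy.of_bound (C := eLpNorm
    (fun x : ℝ => Complex.I / (2 * (Real.pi : ℂ)) * ((x : ℂ) - conj w)⁻¹) 2 volume) ?_
    ((memLp_inv_sub hc).const_mul _).2 fun y hy => ?_
  · intro z hz
    have hz : 0 < z.im := hz
    refine DifferentiableAt.differentiableWithinAt ?_
    refine DifferentiableAt.div (by fun_prop) (by fun_prop) (mul_ne_zero (by simp) ?_)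
    intro h
    have := congrArg Complex.im h
    simp at this
    linarith
  · refine eLpNorm_mono fun x => ?_
    rw [slice, szego_eq, norm_mul, norm_mul, norm_inv, norm_inv]
    gcongr
    · exact norm_pos_iff.2 (sub_ne_zero_of_im_ne_zero hc x)
    · rw [← sq_le_sq₀ (norm_nonneg _) (norm_nonneg _), ← Complex.normSq_eq_norm_sq,
        ← Complex.normSq_eq_norm_sq, Complex.normSq_apply, Complex.normSq_apply]
      simp
      nlinarith

lemma differentiableOn_dslope {F : ℂ → ℂ} (hF : MemHardy F) {z : ℂ} (hz : 0 < z.im) :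
    DifferentiableOn ℂ (dslope F z) upperHalf :=
  (Complex.differentiableOn_dslope (isOpen_upperHalf.mem_nhds hz)).2 hF.1

namespace MemHardy

variable {F : ℂ → ℂ}

/-- This supplies the strip integrability that `integral_slice_eq` requires for `F w / (w - z)`.
Near `z` the singularity is removable and compactness gives a bound; for `|x - z.re| > 1` the
quotient is dominated by a product of two square integrable functions. -/
lemma integrable_dslope_strip (hF : MemHardy F) {z : ℂ} (hz : 0 < z.im) (h0 : F z = 0)
    {a b : ℝ} (ha : 0 < a) :
    Integrable (fun p : ℝ × ℝ => slice (dslope F z) p.2 p.1)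
      (volume.prod (volume.restrict (Set.Icc a b))) := by
  -- The pole is placed at distance `1` from the line, so that `‖k x‖ ^ 2 = ((x - z.re) ^ 2 + 1)⁻¹`:
  -- at least `1 / 2` on the central block, and comparable with `|w - z|⁻²` or larger outside it.
  set k : ℝ → ℂ := fun x => ((x : ℂ) - (z.re - Complex.I))⁻¹ with hk
  have hkc : (z.re - Complex.I : ℂ).im ≠ 0 := by simp
  have hkn : ∀ x : ℝ, ‖k x‖ ^ 2 = ((x - z.re) ^ 2 + 1)⁻¹ := fun x => by
    have h := inv_sub_mul_conj (z.re - Complex.I) x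
    rw [Complex.mul_conj, Complex.normSq_eq_norm_sq] at h
    have := Complex.ofReal_injective h
    simp only [Complex.sub_re, Complex.ofReal_re, Complex.I_re, sub_zero, Complex.sub_im,
      Complex.ofReal_im, Complex.I_im, zero_sub, even_two, Even.neg_pow, one_pow] at this
    exact this
  have hk2 : MemLp (fun p : ℝ × ℝ => k p.1) 2
      ((volume : Measure ℝ).prod (volume.restrict (Set.Icc a b))) :=
    (memLp_inv_sub hkc).comp_fst _
  have hF2 := hF.memLp_strip (g := fun y => y) (a := a) (b := b) (by fun_prop)
    fun y hy => ha.trans_le hy.1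
  have hdiff := differentiableOn_dslope hF hz
  obtain ⟨M, hM⟩ := ((isCompact_Icc (a := z.re - 1) (b := z.re + 1)).reProdIm
    (isCompact_Icc (a := a) (b := b))).exists_bound_of_continuousOn
    (hdiff.continuousOn.mono fun w hw => ha.trans_le hw.2.1)
  have hI : ∀ᵐ p ∂((volume : Measure ℝ).prod (volume.restrict (Set.Icc a b))), p.2 ∈ Set.Icc a b :=
    Measure.quasiMeasurePreserving_snd.ae (ae_restrict_mem measurableSet_Icc)
  have hdom : Integrable (fun p : ℝ × ℝ => 2 * |M| * ‖k p.1‖ ^ 2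
      + 2 * (‖slice F p.2 p.1‖ * ‖k p.1‖))
      ((volume : Measure ℝ).prod (volume.restrict (Set.Icc a b))) :=
    (((memLp_two_iff_integrable_sq_norm hk2.1).1 hk2).const_mul _).add
      ((hF2.norm.integrable_mul hk2.norm).const_mul _)
  refine hdom.mono' ?_ ?_
  · rw [← Measure.restrict_univ (μ := (volume : Measure ℝ)), Measure.restrict_restrict
      measurableSet_Icc, Set.inter_univ, Measure.prod_restrict]
    refine ContinuousOn.aestronglyMeasurable ?_ (MeasurableSet.univ.prod measurableSet_Icc)
    refine hdiff.continuousOn.comp (by fun_prop) fun p hp => ?_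
    simpa using ha.trans_le hp.2.1
  · filter_upwards [hI] with p hp
    by_cases hx : p.1 ∈ Set.Icc (z.re - 1) (z.re + 1)
    · have h1 : ‖slice (dslope F z) p.2 p.1‖ ≤ M := hM _ ⟨by simpa using hx, by simpa using hp⟩
      have h2 : (1 : ℝ) ≤ 2 * ‖k p.1‖ ^ 2 := by
        rw [hkn, ← div_eq_mul_inv, one_le_div (by positivity)]
        nlinarith [hx.1, hx.2]
      have h3 : 0 ≤ 2 * (‖slice F p.2 p.1‖ * ‖k p.1‖) := by positivity
      have h4 : M ≤ |M| * (2 * ‖k p.1‖ ^ 2) :=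
        (le_abs_self M).trans (le_mul_of_one_le_right (abs_nonneg _) h2)
      linarith
    · set w : ℂ := (p.1 : ℂ) + (p.2 : ℂ) * Complex.I with hw
      have hsq : 1 ≤ (p.1 - z.re) ^ 2 := by
        simp only [Set.mem_Icc, not_and_or, not_le] at hx
        rcases hx with hx | hx <;> nlinarith
      have hre : (w - z).re = p.1 - z.re := by simp [hw]
      have hwz : w ≠ z := fun h => by
        rw [h, sub_self, Complex.zero_re] at hre
        rw [← hre] at hsq
        norm_num at hsq
      have e : slice (dslope F z) p.2 p.1 = (w - z)⁻¹ * slice F p.2 p.1 := by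
        rw [slice, dslope_of_ne _ hwz, slope_def_module, h0, sub_zero]
        rfl
      have hkw : ‖(w - z)⁻¹‖ ≤ 2 * ‖k p.1‖ := by
        rw [← sq_le_sq₀ (norm_nonneg _) (by positivity), mul_pow, hkn, norm_inv, inv_pow,
          ← Complex.normSq_eq_norm_sq, Complex.normSq_apply, hre]
        rw [← div_eq_mul_inv, inv_eq_one_div, div_le_div_iff₀ (by nlinarith [sq_nonneg (w - z).im])
          (by positivity)]
        nlinarith [sq_nonneg (w - z).im]
      rw [e, norm_mul]
      have h3 : 0 ≤ 2 * |M| * ‖k p.1‖ ^ 2 := by positivity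
      nlinarith [mul_le_mul_of_nonneg_right hkw (norm_nonneg (slice F p.2 p.1))]

lemma norm_integral_mul_inv_sub_le (hF : MemHardy F) {y : ℝ} (hy : 0 < y) {c : ℂ}
    (hc : c.im ≠ 0) :
    ‖∫ x, slice F y x * ((x : ℂ) - c)⁻¹‖ ≤ √(Real.pi / |c.im|) * ‖sliceLp F y‖ := by
  have hc' : (conj c).im ≠ 0 := by simpa using hc
  have e : ∫ x, slice F y x * ((x : ℂ) - c)⁻¹
      = inner ℂ ((memLp_inv_sub hc').toLp) (sliceLp F y) := by
    rw [hF.sliceLp_eq hy, inner_toLp]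
    simp
  have hn : ‖(memLp_inv_sub hc').toLp‖ = √(Real.pi / |c.im|) := by
    rw [← Real.sqrt_sq (norm_nonneg ((memLp_inv_sub hc').toLp)), norm_toLp_inv_sub_sq hc']
    simp
  rw [e, ← hn]
  exact norm_inner_le_norm _ _

/-- Because `F z = 0`, the quotient `F w / (w - z)` is analytic across `z`, and the line of
integration may be pushed to height `z.im + s`. There Cauchy–Schwarz bounds the integral by a
multiple of `s ^ (-1/2)`, and `s → ∞`. -/
lemma integral_mul_inv_sub_eq_zero (hF : MemHardy F) {z : ℂ} (h0 : F z = 0) {a : ℝ} (ha : 0 < a)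
    (haz : a < z.im) :
    ∫ x, slice F a x * ((x : ℂ) - (z - a * Complex.I))⁻¹ = 0 := by
  have hz : 0 < z.im := ha.trans haz
  have hsl : ∀ y : ℝ, y ≠ z.im → slice (dslope F z) y
      = fun x : ℝ => slice F y x * ((x : ℂ) - (z - y * Complex.I))⁻¹ := fun y hy => funext fun x => by
    have hne : (x : ℂ) + y * Complex.I ≠ z := fun h => by
      rw [← h] at hy
      simp at hy
    rw [slice, dslope_of_ne _ hne, slope_def_module, h0, sub_zero, smul_eq_mul, mul_comm]
    congr 2
    ring
  have him : ∀ y : ℝ, (z - y * Complex.I).im = z.im - y := fun y => by simp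
  have hint : ∀ y : ℝ, 0 < y → y ≠ z.im → Integrable (slice (dslope F z) y) := fun y hy hne => by
    rw [hsl y hne]
    exact (hF.memLp_slice hy).integrable_mul
      (memLp_inv_sub (by rw [him]; exact sub_ne_zero.2 hne.symm))
  obtain ⟨C, hC⟩ := hF.exists_norm_sliceLp_le
  have key : ∀ s : ℝ, 0 < s → ‖∫ x, slice F a x * ((x : ℂ) - (z - a * Complex.I))⁻¹‖
      ≤ √(Real.pi / s) * C := fun s hs => by
    have hY : 0 < z.im + s := by linarith
    have h := integral_slice_eq (G := dslope F z) (a := a) (b := z.im + s) (by linarith)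
      ((differentiableOn_dslope hF hz).mono fun w hw => ha.trans_le hw.1) (hint a ha haz.ne)
      (hint _ hY (by linarith)) (hF.integrable_dslope_strip hz h0 ha)
    rw [hsl a haz.ne, hsl (z.im + s) (by linarith)] at h
    rw [h]
    have him' : (z - ((z.im + s : ℝ) : ℂ) * Complex.I).im = -s := by rw [him]; ring
    refine (hF.norm_integral_mul_inv_sub_le hY (by rw [him']; linarith)).trans ?_
    rw [him', abs_neg, abs_of_pos hs]
    gcongr
    exact hC _ hY
  have hlim : Tendsto (fun s : ℝ => √(Real.pi / s) * C) atTop (𝓝 0) := by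
    have := ((tendsto_const_nhds (x := Real.pi)).div_atTop tendsto_id).sqrt.mul_const C
    simpa using this
  exact norm_le_zero_iff.1 (ge_of_tendsto hlim ((eventually_gt_atTop 0).mono key))

/-- The Cauchy formula on a horizontal line close to the real axis. -/
lemma eq_integral_szego (hF : MemHardy F) {z : ℂ} {a : ℝ} (ha : 0 < a) (haz : 2 * a < z.im) :
    F z = ∫ x, slice F a x * conj (szego (z - a * Complex.I) x) := by
  -- `conj w₀` is the conjugate-symmetric image of `z` in the line of height `a`. On that line the
  -- kernel of `w₀` times `1 / (w - z)` is a constant times the Poisson-type function `((x - z.re) ^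
  -- 2 + d ^ 2)⁻¹`, whose integral is explicit. The bound `2 * a < z.im` keeps `w₀` in the
  -- half-plane.
  set w₀ : ℂ := z - (2 * a : ℝ) * Complex.I with hw₀
  have hw₀im : 0 < w₀.im := by simp [hw₀]; linarith
  set d : ℝ := z.im - a with hd
  have hd0 : d ≠ 0 := by simp only [hd]; linarith
  have hdpos : 0 < d := by simp only [hd]; linarith
  have hpi : (Real.pi : ℂ) ≠ 0 := by simp [Real.pi_ne_zero]
  have hdc : (d : ℂ) ≠ 0 := by exact_mod_cast hd0
  -- Since `szego w₀ z = 1 / (4 π d)`, this multiple of the kernel takes the value `F z` at `z`.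
  set c : ℂ := 4 * Real.pi * d * F z with hc
  have hzp : z - conj w₀ = 2 * d * Complex.I := by
    apply Complex.ext <;> simp [hw₀, hd]
    ring
  have hQ0 : (F - c • szego w₀) z = 0 := by
    simp only [Pi.sub_apply, Pi.smul_apply, smul_eq_mul, szego, hzp, hc]
    field_simp
    ring
  have hK := memHardy_szego hw₀im
  have hcim : (z - a * Complex.I).im ≠ 0 := by simpa [hd] using hd0
  have h := (hF.sub (hK.const_smul c)).integral_mul_inv_sub_eq_zero hQ0 ha (by linarith)
  have hterm : ∀ x : ℝ, slice (c • szego w₀) a x * ((x : ℂ) - (z - a * Complex.I))⁻¹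
      = c * (Complex.I / (2 * Real.pi)) * (((x - z.re) ^ 2 + d ^ 2)⁻¹ : ℝ) := fun x => by
    have h1 := inv_sub_mul_conj (z - a * Complex.I) x
    have h2 : (x : ℂ) + a * Complex.I - conj w₀ = conj ((x : ℂ) - (z - a * Complex.I)) := by
      apply Complex.ext <;> simp [hw₀]
      ring
    have h3 : (z - a * Complex.I).re = z.re := by simp
    have h4 : (z - a * Complex.I).im = d := by simp [hd]
    rw [h3, h4] at h1
    rw [← h1]
    simp only [slice, Pi.smul_apply, smul_eq_mul, szego_eq, h2, map_inv₀]
    ring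
  have hsub : ∀ x : ℝ, slice (F - c • szego w₀) a x = slice F a x - slice (c • szego w₀) a x :=
    fun x => rfl
  simp only [hsub, sub_mul] at h
  have hi1 : Integrable fun x : ℝ => slice F a x * ((x : ℂ) - (z - a * Complex.I))⁻¹ :=
    (hF.memLp_slice ha).integrable_mul (memLp_inv_sub hcim)
  have hi2 : Integrable fun x : ℝ =>
      slice (c • szego w₀) a x * ((x : ℂ) - (z - a * Complex.I))⁻¹ :=
    ((hK.const_smul c).memLp_slice ha).integrable_mul (memLp_inv_sub hcim)
  rw [integral_sub hi1 hi2, sub_eq_zero] at h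
  simp only [hterm] at h
  rw [integral_const_mul, integral_complex_ofReal, integral_inv_sq_add_sq _ hd0,
    abs_of_pos hdpos] at h
  have hconj : ∀ x : ℝ, slice F a x * conj (szego (z - a * Complex.I) x)
      = -Complex.I / (2 * Real.pi) * (slice F a x * ((x : ℂ) - (z - a * Complex.I))⁻¹) := fun x => by
    rw [szego_eq]
    simp only [map_mul, map_div₀, map_inv₀, map_sub, Complex.conj_conj, Complex.conj_ofReal,
      Complex.conj_I, map_ofNat, map_neg, neg_neg]
    ring
  simp only [hconj]
  rw [integral_const_mul, h, hc]
  push_cast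
  field_simp
  rw [Complex.I_sq]
  ring

end MemHardy

/-! ### The reproducing formula for boundary values -/

lemma memLp_szego {w : ℂ} (hw : 0 < w.im) :
    MemLp (fun x : ℝ => szego w x) 2 volume := by
  have hc : (conj w).im ≠ 0 := by simpa using hw.ne'
  simp only [szego_eq]
  exact (memLp_inv_sub hc).const_mul _

open Classical in
/-- The boundary values of the Szegő kernel, as an element of `L²(ℝ)`. -/
def szegoLp (w : ℂ) : Lp ℂ 2 (volume : Measure ℝ) :=
  if h : 0 < w.im then (memLp_szego h).toLp else 0

lemma szegoLp_of_pos {w : ℂ} (hw : 0 < w.im) : szegoLp w = (memLp_szego hw).toLp := dif_pos hw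

/-- The resolvent identity writes the difference as `conj (z - w) / (x - conj z)` times the kernel
of `w`, and `|x - conj z| ≥ z.im`. -/
lemma norm_szegoLp_sub_le {z w : ℂ} (hz : 0 < z.im) (hw : 0 < w.im) :
    ‖szegoLp z - szegoLp w‖ ≤ ‖z - w‖ / z.im * ‖szegoLp w‖ := by
  refine Lp.norm_le_mul_norm_of_ae_le_mul ?_
  rw [szegoLp_of_pos hz, szegoLp_of_pos hw]
  filter_upwards [Lp.coeFn_sub ((memLp_szego hz).toLp) ((memLp_szego hw).toLp),
    (memLp_szego hz).coeFn_toLp, (memLp_szego hw).coeFn_toLp] with x h1 h2 h3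
  rw [h1, Pi.sub_apply, h2, h3, szego_eq, szego_eq]
  have hxz := sub_ne_zero_of_im_ne_zero (c := conj z) (by simpa using hz.ne') x
  have hxw := sub_ne_zero_of_im_ne_zero (c := conj w) (by simpa using hw.ne') x
  have e : Complex.I / (2 * (Real.pi : ℂ)) * ((x : ℂ) - conj z)⁻¹
      - Complex.I / (2 * (Real.pi : ℂ)) * ((x : ℂ) - conj w)⁻¹
      = conj (z - w) * ((x : ℂ) - conj z)⁻¹ *
        (Complex.I / (2 * (Real.pi : ℂ)) * ((x : ℂ) - conj w)⁻¹) := by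
    rw [map_sub]
    field_simp
    ring
  rw [e, norm_mul, norm_mul, RCLike.norm_conj, norm_inv, div_eq_mul_inv ‖z - w‖]
  gcongr
  refine le_trans ?_ (Complex.abs_im_le_norm _)
  simp [le_abs_self]

lemma continuousAt_szegoLp {w : ℂ} (hw : 0 < w.im) : ContinuousAt szegoLp w := by
  rw [ContinuousAt, tendsto_iff_norm_sub_tendsto_zero]
  have hlim : Tendsto (fun z : ℂ => ‖z - w‖ / z.im * ‖szegoLp w‖) (𝓝 w) (𝓝 0) := by
    have : ContinuousAt (fun z : ℂ => ‖z - w‖ / z.im * ‖szegoLp w‖) w :=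
      ((by fun_prop : ContinuousAt (fun z : ℂ => ‖z - w‖) w).div (by fun_prop) hw.ne').mul
        continuousAt_const
    simpa [ContinuousAt] using this
  refine squeeze_zero' (Eventually.of_forall fun _ => norm_nonneg _) ?_ hlim
  filter_upwards [isOpen_upperHalf.mem_nhds hw] with z hz
  exact norm_szegoLp_sub_le hz hw

lemma continuousOn_szegoLp : ContinuousOn szegoLp upperHalf :=
  fun _ hw => (continuousAt_szegoLp hw).continuousWithinAt

lemma tendsto_add_mul_I (w : ℂ) :
    Tendsto (fun a : ℝ => w + a * Complex.I) (𝓝[>] 0) (𝓝 w) := by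
  have : ContinuousAt (fun a : ℝ => w + a * Complex.I) 0 := by fun_prop
  simpa [ContinuousAt] using this.tendsto.mono_left nhdsWithin_le_nhds

lemma tendsto_sub_mul_I (w : ℂ) :
    Tendsto (fun a : ℝ => w - a * Complex.I) (𝓝[>] 0) (𝓝 w) := by
  have : ContinuousAt (fun a : ℝ => w - a * Complex.I) 0 := by fun_prop
  simpa [ContinuousAt] using this.tendsto.mono_left nhdsWithin_le_nhds

lemma sliceLp_szego {w : ℂ} (hw : 0 < w.im) {a : ℝ} (ha : 0 < a) :
    sliceLp (szego w) a = szegoLp (w + a * Complex.I) := by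
  have h : 0 < (w + a * Complex.I).im := by simp; linarith
  rw [(memHardy_szego hw).sliceLp_eq ha, szegoLp_of_pos h]
  congr 1
  funext x
  simp only [slice, szego, map_add, map_mul, Complex.conj_ofReal, Complex.conj_I]
  congr 2
  ring

lemma tendsto_sliceLp_szego {w : ℂ} (hw : 0 < w.im) :
    Tendsto (sliceLp (szego w)) (𝓝[>] 0) (𝓝 (szegoLp w)) := by
  refine ((continuousAt_szegoLp hw).tendsto.comp (tendsto_add_mul_I w)).congr' ?_
  filter_upwards [self_mem_nhdsWithin] with a ha
  exact (sliceLp_szego hw ha).symm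

/-- A Hardy function is the Cauchy integral of its boundary values. -/
lemma MemHardy.eq_inner {F : ℂ → ℂ} (hF : MemHardy F) {φ : Lp ℂ 2 (volume : Measure ℝ)}
    (hφ : Tendsto (sliceLp F) (𝓝[>] 0) (𝓝 φ)) {z : ℂ} (hz : 0 < z.im) :
    F z = inner ℂ (szegoLp z) φ := by
  -- The Cauchy formula at height `a` equates `F z` with this pairing for all small `a`; both
  -- entries converge in `L²(ℝ)` as `a ↓ 0`.
  have h : Tendsto (fun a : ℝ => inner ℂ (szegoLp (z - a * Complex.I)) (sliceLp F a))
      (𝓝[>] 0) (𝓝 (inner ℂ (szegoLp z) φ)) :=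
    ((continuousAt_szegoLp hz).tendsto.comp (tendsto_sub_mul_I z)).inner hφ
  refine tendsto_nhds_unique (tendsto_const_nhds.congr' ?_) h
  filter_upwards [Ioo_mem_nhdsGT (half_pos hz)] with a ha
  have hp : 0 < (z - a * Complex.I).im := by
    have := ha.2
    simp; linarith
  rw [szegoLp_of_pos hp, hF.sliceLp_eq ha.1, inner_toLp]
  exact hF.eq_integral_szego ha.1 (by linarith [ha.2])

/-- The reproducing formula applied to the kernel itself. This Gram matrix is the integral kernel of
𝒦. -/
lemma inner_szegoLp {z w : ℂ} (hz : 0 < z.im) (hw : 0 < w.im) :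
    inner ℂ (szegoLp z) (szegoLp w) = szego w z :=
  ((memHardy_szego hw).eq_inner (tendsto_sliceLp_szego hw) hz).symm

/-! ### The Hardy space as a closed subspace of `L²(ℝ)` -/

/-- The space of boundary values of Hardy functions. -/
def hardySpace : Submodule ℂ (Lp ℂ 2 (volume : Measure ℝ)) where
  carrier := {φ | ∃ F, MemHardy F ∧ Tendsto (sliceLp F) (𝓝[>] 0) (𝓝 φ)}
  zero_mem' := by
    have hI : 0 < Complex.I.im := by simp
    have h := (memHardy_szego hI).const_smul 0
    refine ⟨_, h, ?_⟩
    have := (tendsto_sliceLp_szego hI).const_smul (0 : ℂ)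
    rw [zero_smul] at this
    refine this.congr' ?_
    filter_upwards [self_mem_nhdsWithin] with y hy
    rw [(memHardy_szego hI).sliceLp_const_smul _ hy]
  add_mem' := by
    rintro _ _ ⟨F, hF, hφ⟩ ⟨G, hG, hψ⟩
    refine ⟨_, hF.add hG, (hφ.add hψ).congr' ?_⟩
    filter_upwards [self_mem_nhdsWithin] with y hy
    rw [hF.sliceLp_add hG hy]
  smul_mem' := by
    rintro c _ ⟨F, hF, hφ⟩
    refine ⟨_, hF.const_smul c, (hφ.const_smul c).congr' ?_⟩
    filter_upwards [self_mem_nhdsWithin] with y hy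
    rw [hF.sliceLp_const_smul c hy]

lemma szegoLp_mem_hardySpace {w : ℂ} (hw : 0 < w.im) : szegoLp w ∈ hardySpace :=
  ⟨_, memHardy_szego hw, tendsto_sliceLp_szego hw⟩

lemma norm_sliceLp_sub_le {F G : ℂ → ℂ} (hF : MemHardy F) (hG : MemHardy G)
    {φ ψ : Lp ℂ 2 (volume : Measure ℝ)} (hφ : Tendsto (sliceLp F) (𝓝[>] 0) (𝓝 φ))
    (hψ : Tendsto (sliceLp G) (𝓝[>] 0) (𝓝 ψ)) {y : ℝ} (hy : 0 < y) :
    ‖sliceLp F y - sliceLp G y‖ ≤ ‖φ - ψ‖ := by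
  rw [← hF.sliceLp_sub hG hy]
  refine (hF.sub hG).norm_sliceLp_le ((hφ.sub hψ).congr' ?_) hy
  filter_upwards [self_mem_nhdsWithin] with y hy
  rw [hF.sliceLp_sub hG hy]

/-- The candidate for the limit is the Cauchy integral of `φ₀`. Kernel norms are bounded on compact
sets, so the convergence is locally uniform and the limit analytic; Fatou's lemma bounds its slices.
-/
lemma isClosed_hardySpace : IsClosed (hardySpace : Set (Lp ℂ 2 (volume : Measure ℝ))) := by
  refine IsSeqClosed.isClosed fun φ φ₀ hmem hlim => ?_
  choose F hF hFφ using hmem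
  set F₀ : ℂ → ℂ := fun z => inner ℂ (szegoLp z) φ₀ with hF₀
  have hpt : ∀ z ∈ upperHalf, Tendsto (fun n => F n z) atTop (𝓝 (F₀ z)) := fun z hz => by
    refine ((tendsto_const_nhds (x := szegoLp z)).inner hlim).congr fun n => ?_
    exact ((hF n).eq_inner (hFφ n) hz).symm
  have hd : DifferentiableOn ℂ F₀ upperHalf := by
    refine TendstoLocallyUniformlyOn.differentiableOn (F := F) (φ := atTop) ?_
      (Eventually.of_forall fun n => (hF n).1) isOpen_upperHalf
    rw [tendstoLocallyUniformlyOn_iff_forall_isCompact isOpen_upperHalf]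
    intro K hK hKc
    obtain ⟨M, hM⟩ := hKc.exists_bound_of_continuousOn (continuousOn_szegoLp.mono hK)
    rw [Metric.tendstoUniformlyOn_iff]
    intro ε hε
    have h0 : Tendsto (fun n => M * ‖φ₀ - φ n‖) atTop (𝓝 0) := by
      have := ((tendsto_const_nhds (x := φ₀)).sub hlim).norm.const_mul M
      simpa using this
    filter_upwards [h0.eventually (gt_mem_nhds hε)] with n hn z hz
    rw [dist_eq_norm, (hF n).eq_inner (hFφ n) (hK hz), hF₀, ← inner_sub_right]
    refine ((norm_inner_le_norm _ _).trans ?_).trans_lt hn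
    exact mul_le_mul_of_nonneg_right (hM z hz) (norm_nonneg _)
  -- Keeping `G` general lets this serve twice: `G = F 0` bounds the slices of `F₀`, and `G = F n`
  -- identifies its boundary value.
  have hfatou : ∀ {G : ℂ → ℂ} {ψ : Lp ℂ 2 (volume : Measure ℝ)}, MemHardy G →
      Tendsto (sliceLp G) (𝓝[>] 0) (𝓝 ψ) → ∀ y, 0 < y →
      eLpNorm (fun x => slice F₀ y x - slice G y x) 2 volume ≤ ‖φ₀ - ψ‖ₑ := by
    intro G ψ hG hψ y hy
    refine (Lp.eLpNorm_lim_le_liminf_eLpNorm (f := fun n x => slice (F n) y x - slice G y x)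
      (fun n => (((hF n).continuous_slice hy).sub (hG.continuous_slice hy)).aestronglyMeasurable) _
      (Eventually.of_forall fun x =>
        (hpt _ (by simpa using hy)).sub tendsto_const_nhds)).trans ?_
    have hl : Tendsto (fun n => ‖φ n - ψ‖ₑ) atTop (𝓝 ‖φ₀ - ψ‖ₑ) :=
      (hlim.sub tendsto_const_nhds).enorm
    rw [← hl.liminf_eq]
    refine liminf_le_liminf (Eventually.of_forall fun n => ?_)
    have h1 := norm_sliceLp_sub_le (hF n) hG (hFφ n) hψ hy
    rw [← (hF n).sliceLp_sub hG hy, ((hF n).sub hG).sliceLp_eq hy] at h1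
    have h2 : ‖(((hF n).sub hG).memLp_slice hy).toLp‖ₑ ≤ ‖φ n - ψ‖ₑ := enorm_le_iff_norm_le.2 h1
    rwa [Lp.enorm_toLp] at h2
  have hF₀H : MemHardy F₀ := by
    refine MemHardy.of_bound hd (C := ‖φ₀ - φ 0‖ₑ + ‖φ 0‖ₑ)
      (ENNReal.add_lt_top.2 ⟨enorm_lt_top, enorm_lt_top⟩) fun y hy => ?_
    have e : slice F₀ y = (fun x => slice F₀ y x - slice (F 0) y x) + slice (F 0) y := by
      funext x; simp
    have hm : Continuous (slice F₀ y) :=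
      hd.continuousOn.comp_continuous (continuous_line y) fun x => by simpa using hy
    have h1 : ‖sliceLp (F 0) y‖ₑ ≤ ‖φ 0‖ₑ :=
      enorm_le_iff_norm_le.2 ((hF 0).norm_sliceLp_le (hFφ 0) hy)
    rw [(hF 0).sliceLp_eq hy, Lp.enorm_toLp] at h1
    rw [e]
    exact (eLpNorm_add_le (hm.sub ((hF 0).continuous_slice hy)).aestronglyMeasurable
      ((hF 0).continuous_slice hy).aestronglyMeasurable (by norm_num)).trans
      (add_le_add (hfatou (hF 0) (hFφ 0) y hy) h1)
  -- `F₀` has some boundary value `φ'`, not yet known to be `φ₀`. The Fatou bound gives `‖φ' - φ n‖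
  -- ≤ ‖φ₀ - φ n‖`, so `φ n` tends to both.
  obtain ⟨φ', hφ'⟩ := hF₀H.exists_tendsto_sliceLp
  have hle : ∀ n, ‖φ' - φ n‖ ≤ ‖φ₀ - φ n‖ := fun n => by
    refine le_of_tendsto (hφ'.sub (hFφ n)).norm ?_
    filter_upwards [self_mem_nhdsWithin] with y hy
    have h := hfatou (hF n) (hFφ n) y hy
    rw [← hF₀H.sliceLp_sub (hF n) hy, (hF₀H.sub (hF n)).sliceLp_eq hy, ← enorm_le_iff_norm_le,
      Lp.enorm_toLp]
    exact h
  have hlim' : Tendsto φ atTop (𝓝 φ') := by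
    rw [tendsto_iff_norm_sub_tendsto_zero]
    have h0 : Tendsto (fun n => ‖φ₀ - φ n‖) atTop (𝓝 0) := by
      simpa using ((tendsto_const_nhds (x := φ₀)).sub hlim).norm
    refine squeeze_zero (fun _ => norm_nonneg _) (fun n => ?_) h0
    rw [norm_sub_rev]
    exact hle n
  rw [tendsto_nhds_unique hlim hlim']
  exact ⟨F₀, hF₀H, hφ'⟩

/-! ### Expansions in an orthogonal sequence with squared norms `lam n`, possibly zero -/

section OrthogonalExpansion

variable {H : Type*} [NormedAddCommGroup H] [InnerProductSpace ℂ H] {v : ℕ → H} {lam : ℕ → ℝ}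

lemma lam_eq_norm_sq (hv : ∀ n, inner ℂ (v n) (v n) = (lam n : ℂ)) (n : ℕ) :
    lam n = ‖v n‖ ^ 2 := by
  have h := hv n
  rw [inner_self_eq_norm_sq_complex, ← Complex.ofReal_pow] at h
  exact (Complex.ofReal_injective h).symm

lemma lam_nonneg (hv : ∀ n, inner ℂ (v n) (v n) = (lam n : ℂ)) (n : ℕ) : 0 ≤ lam n := by
  rw [lam_eq_norm_sq hv]
  positivity

/-- The hypothesis at `l = 0` excludes the one case of disagreement: a nonzero numerator over `0` is
`∞` in `ℝ≥0∞` but `0` in `ℝ`, whereas `0 / 0 = 0` in both. -/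
lemma enorm_sq_div_eq_ofReal {c : ℂ} {l : ℝ} (hl : 0 ≤ l) (h0 : l = 0 → c = 0) :
    ‖c‖ₑ ^ 2 / ENNReal.ofReal l = ENNReal.ofReal (‖c‖ ^ 2 / l) := by
  rcases hl.eq_or_lt with h | h
  · simp [h0 h.symm]
  · rw [ENNReal.ofReal_div_of_pos h, ENNReal.ofReal_pow (norm_nonneg _), ofReal_norm]

lemma eq_zero_of_enorm_sq_div_lt_top {c : ℂ} {l : ℝ} (h : ‖c‖ₑ ^ 2 / ENNReal.ofReal l < ∞)
    (h0 : l = 0) : c = 0 := by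
  by_contra hc
  rw [h0, ENNReal.ofReal_zero, ENNReal.div_zero (by simpa using hc)] at h
  exact lt_irrefl _ h

/-- Bessel's inequality, without normalising the `v n`, since some of them may vanish. -/
lemma tsum_enorm_sq_div_lt_top (hv : ∀ n, inner ℂ (v n) (v n) = (lam n : ℂ))
    (horth : Pairwise fun m n => inner ℂ (v m) (v n) = 0) (φ : H) :
    ∑' n, ‖(inner ℂ (v n) φ : ℂ)‖ₑ ^ 2 / ENNReal.ofReal (lam n) < ∞ := by
  have h0 : ∀ n, lam n = 0 → (inner ℂ (v n) φ : ℂ) = 0 := fun n hn => by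
    rw [lam_eq_norm_sq hv] at hn
    have : v n = 0 := by simpa using hn
    rw [this, inner_zero_left]
  refine lt_of_le_of_lt (b := ENNReal.ofReal (‖φ‖ ^ 2)) ?_ ENNReal.ofReal_lt_top
  rw [ENNReal.tsum_eq_iSup_sum]
  refine iSup_le fun s => ?_
  rw [Finset.sum_congr rfl fun n _ => enorm_sq_div_eq_ofReal (lam_nonneg hv n) (h0 n),
    ← ENNReal.ofReal_sum_of_nonneg fun n _ => div_nonneg (by positivity) (lam_nonneg hv n)]
  refine ENNReal.ofReal_le_ofReal ?_
  set c : ℕ → ℂ := fun n => inner ℂ (v n) φ with hc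
  -- `p` is the orthogonal projection of `φ` to the span of the `v n` with `n ∈ s`. Hence `⟪p, φ⟫ =
  -- ‖p‖ ^ 2 = S`, and Cauchy–Schwarz gives `S ≤ ‖φ‖ ^ 2`.
  set p : H := ∑ n ∈ s, (c n / lam n) • v n with hp
  set S : ℝ := ∑ n ∈ s, ‖c n‖ ^ 2 / lam n with hS
  have hcS : (∑ n ∈ s, conj (c n / lam n) * c n) = (S : ℂ) := by
    rw [hS]
    push_cast
    refine Finset.sum_congr rfl fun n _ => ?_
    rw [map_div₀, Complex.conj_ofReal, div_mul_eq_mul_div, Complex.conj_mul']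
  have h1 : inner ℂ p φ = (S : ℂ) := by
    rw [← hcS, hp, sum_inner]
    refine Finset.sum_congr rfl fun n _ => ?_
    rw [inner_smul_left]
  have h2 : inner ℂ p p = (S : ℂ) := by
    rw [← hcS]
    conv_lhs => rw [hp, sum_inner]
    refine Finset.sum_congr rfl fun n hn => ?_
    rw [inner_smul_left, inner_sum, Finset.sum_eq_single n, inner_smul_right, hv]
    · congr 1
      by_cases hl : lam n = 0
      · simp [hc, h0 n hl]
      · have : (lam n : ℂ) ≠ 0 := by exact_mod_cast hl
        field_simp
    · intro m _ hmn
      rw [inner_smul_right, horth hmn.symm, mul_zero]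
    · exact fun h => absurd hn h
  have h3 : S = ‖p‖ ^ 2 := by
    rw [inner_self_eq_norm_sq_complex, ← Complex.ofReal_pow] at h2
    exact (Complex.ofReal_injective h2).symm
  have h4 : S ≤ ‖p‖ * ‖φ‖ := by
    have := norm_inner_le_norm (𝕜 := ℂ) p φ
    rw [h1, Complex.norm_real] at this
    exact (Real.le_norm_self _).trans this
  nlinarith [sq_nonneg (‖p‖ - ‖φ‖), norm_nonneg p, norm_nonneg φ]

/-- The terms are orthogonal, and their squared norms are the terms of the convergent series `∑ ‖c
n‖ ^ 2 / lam n`. Working with the lines spanned by the `v n` allows zero vectors. -/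
lemma summable_div_smul [CompleteSpace H] (hv : ∀ n, inner ℂ (v n) (v n) = (lam n : ℂ))
    (horth : Pairwise fun m n => inner ℂ (v m) (v n) = 0) {c : ℕ → ℂ}
    (hc : ∑' n, ‖c n‖ₑ ^ 2 / ENNReal.ofReal (lam n) < ∞) :
    Summable fun n => (c n / lam n) • v n := by
  have h0 : ∀ n, lam n = 0 → c n = 0 := fun n =>
    eq_zero_of_enorm_sq_div_lt_top ((ENNReal.le_tsum n).trans_lt hc)
  have hfam : OrthogonalFamily ℂ (fun n => ↥(ℂ ∙ v n)) fun n => (ℂ ∙ v n).subtypeₗᵢ := by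
    refine OrthogonalFamily.of_pairwise fun m n hmn => ?_
    exact Submodule.isOrtho_span.2 (by rintro _ rfl _ rfl; exact horth hmn)
  have h := hfam.summable_iff_norm_sq_summable
    fun n => ⟨(c n / lam n) • v n, Submodule.smul_mem _ _ (Submodule.mem_span_singleton_self _)⟩
  refine h.2 ?_
  refine (ENNReal.summable_toReal hc.ne).congr fun n => ?_
  rw [enorm_sq_div_eq_ofReal (lam_nonneg hv n) (h0 n),
    ENNReal.toReal_ofReal (div_nonneg (by positivity) (lam_nonneg hv n)), Submodule.coe_norm,
    norm_smul, mul_pow, ← lam_eq_norm_sq hv, norm_div, Complex.norm_real, div_pow,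
    Real.norm_eq_abs, sq_abs]
  by_cases hl : lam n = 0
  · simp [hl]
  · field_simp

end OrthogonalExpansion

/-! ### The arc length measure and the identity theorem along the curve -/

section Curve

variable {γ : ℝ → ℂ} {a b : ℝ}

namespace IsSmoothCurve

lemma continuousOn_derivWithin (hγ : IsSmoothCurve γ a b) :
    ContinuousOn (derivWithin γ (Set.Icc a b)) (Set.Icc a b) :=
  hγ.contDiffOn.continuousOn_derivWithin (uniqueDiffOn_Icc hγ.lt) le_rfl

lemma aemeasurable (hγ : IsSmoothCurve γ a b) :
    AEMeasurable γ ((volume.restrict (Set.Icc a b)).withDensity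
      fun t => ‖derivWithin γ (Set.Icc a b) t‖ₑ) :=
  (hγ.contDiffOn.continuousOn.aemeasurable measurableSet_Icc).mono_ac
    (withDensity_absolutelyContinuous _ _)

lemma aemeasurable_density (hγ : IsSmoothCurve γ a b) :
    AEMeasurable (fun t => ‖derivWithin γ (Set.Icc a b) t‖ₑ) (volume.restrict (Set.Icc a b)) :=
  (hγ.continuousOn_derivWithin.aemeasurable measurableSet_Icc).enorm

lemma isFiniteMeasure (hγ : IsSmoothCurve γ a b) : IsFiniteMeasure (arcLength γ a b) := by
  have hi : IntegrableOn (derivWithin γ (Set.Icc a b)) (Set.Icc a b) :=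
    hγ.continuousOn_derivWithin.integrableOn_compact isCompact_Icc
  have : IsFiniteMeasure ((volume.restrict (Set.Icc a b)).withDensity
      fun t => ‖derivWithin γ (Set.Icc a b) t‖ₑ) := isFiniteMeasure_withDensity hi.2.ne
  exact Measure.isFiniteMeasure_map _ _

lemma isCompact_image (hγ : IsSmoothCurve γ a b) : IsCompact (γ '' Set.Icc a b) :=
  isCompact_Icc.image_of_continuousOn hγ.contDiffOn.continuousOn

lemma image_subset (hγ : IsSmoothCurve γ a b) : γ '' Set.Icc a b ⊆ upperHalf := by
  rintro _ ⟨t, ht, rfl⟩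
  exact hγ.im_pos t ht

lemma ae_mem_image (hγ : IsSmoothCurve γ a b) :
    ∀ᵐ ζ ∂(arcLength γ a b), ζ ∈ γ '' Set.Icc a b := by
  refine (ae_map_iff (p := fun ζ => ζ ∈ γ '' Set.Icc a b) hγ.aemeasurable
    hγ.isCompact_image.measurableSet).2 ?_
  refine (withDensity_absolutelyContinuous _ _).ae_le ?_
  filter_upwards [ae_restrict_mem measurableSet_Icc] with t ht
  exact Set.mem_image_of_mem _ ht

lemma ae_im_pos (hγ : IsSmoothCurve γ a b) : ∀ᵐ ζ ∂(arcLength γ a b), 0 < ζ.im :=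
  hγ.ae_mem_image.mono fun _ h => hγ.image_subset h

/-- Analytic functions that agree almost everywhere on the curve agree on the half-plane. -/
lemma eqOn_of_ae_eq (hγ : IsSmoothCurve γ a b) {F G : ℂ → ℂ} (hF : DifferentiableOn ℂ F upperHalf)
    (hG : DifferentiableOn ℂ G upperHalf) (h : F =ᵐ[arcLength γ a b] G) :
    Set.EqOn F G upperHalf := by
  have h1 : ∀ᵐ t ∂((volume.restrict (Set.Icc a b)).withDensity
      fun t => ‖derivWithin γ (Set.Icc a b) t‖ₑ), F (γ t) = G (γ t) :=
    ae_of_ae_map hγ.aemeasurable h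
  rw [ae_withDensity_iff' hγ.aemeasurable_density, ae_restrict_iff' measurableSet_Icc] at h1
  have h2 : ∀ᵐ t, t ∈ Set.Icc a b → F (γ t) = G (γ t) := by
    filter_upwards [h1] with t ht hm
    exact ht hm (by simpa using hγ.deriv_ne_zero t hm)
  set t₀ : ℝ := (a + b) / 2 with ht₀
  have hlt := hγ.lt
  have hIoo : t₀ ∈ Set.Ioo a b := ⟨by simp only [ht₀]; linarith, by simp only [ht₀]; linarith⟩
  have hIcc := Set.Ioo_subset_Icc_self hIoo
  have hnhds : Set.Icc a b ∈ 𝓝 t₀ := Icc_mem_nhds hIoo.1 hIoo.2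
  have hder : HasDerivAt γ (derivWithin γ (Set.Icc a b) t₀) t₀ :=
    (((hγ.contDiffOn.differentiableOn one_ne_zero) t₀ hIcc).hasDerivWithinAt).hasDerivAt hnhds
  -- The density is nonzero, so agreement holds for Lebesgue almost every parameter; such parameters
  -- accumulate at the midpoint `t₀`.
  have hfreq : ∃ᶠ t in 𝓝[≠] t₀, F (γ t) = G (γ t) := by
    have h3 : ∃ᶠ t in 𝓝[>] t₀, F (γ t) = G (γ t) := by
      rw [Filter.Frequently]
      intro hcon
      obtain ⟨u, hu, hsub⟩ := mem_nhdsGT_iff_exists_Ioo_subset.1 hcon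
      have hu : t₀ < u := hu
      have hpos : 0 < volume (Set.Ioo t₀ (min u b)) := by
        simp [Real.volume_Ioo, hu, hIoo.2]
      refine hpos.ne' (measure_mono_null (fun t ht => ?_) (ae_iff.1 h2))
      simp only [Set.mem_Ioo, lt_min_iff] at ht
      simp only [Set.mem_ofPred_eq, Classical.not_imp]
      exact ⟨⟨hIoo.1.le.trans ht.1.le, ht.2.2.le⟩, hsub ⟨ht.1, ht.2.1⟩⟩
    exact h3.filter_mono (nhdsWithin_mono _ fun x hx => ne_of_gt hx)
  -- As `γ` has nonzero derivative at `t₀`, it avoids the value `γ t₀` at nearby parameters. The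
  -- points of agreement thus accumulate at `γ t₀` without being equal to it, as the identity
  -- theorem demands; simplicity of the curve plays no role.
  have htend : Tendsto γ (𝓝[≠] t₀) (𝓝[≠] (γ t₀)) :=
    tendsto_nhdsWithin_iff.2 ⟨hder.continuousAt.tendsto.mono_left nhdsWithin_le_nhds,
      hder.eventually_ne (hγ.deriv_ne_zero t₀ hIcc)⟩
  refine (hF.analyticOnNhd isOpen_upperHalf).eqOn_of_preconnected_of_frequently_eq
    (hG.analyticOnNhd isOpen_upperHalf) (convex_halfSpace_im_gt 0).isPreconnected
    (hγ.im_pos t₀ hIcc) (htend.frequently hfreq)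

lemma exists_norm_szegoLp_le (hγ : IsSmoothCurve γ a b) :
    ∃ M, ∀ᵐ τ ∂(arcLength γ a b), ‖szegoLp τ‖ ≤ M := by
  obtain ⟨M, hM⟩ := hγ.isCompact_image.exists_bound_of_continuousOn
    (continuousOn_szegoLp.mono hγ.image_subset)
  exact ⟨M, hγ.ae_mem_image.mono hM⟩

lemma restrict_upperHalf (hγ : IsSmoothCurve γ a b) :
    (arcLength γ a b).restrict upperHalf = arcLength γ a b :=
  Measure.restrict_eq_self_of_ae_mem hγ.ae_im_pos

lemma aestronglyMeasurable_szegoLp (hγ : IsSmoothCurve γ a b) :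
    AEStronglyMeasurable szegoLp (arcLength γ a b) := by
  rw [← hγ.restrict_upperHalf]
  exact continuousOn_szegoLp.aestronglyMeasurable isOpen_upperHalf.measurableSet

lemma memLp_inner_szegoLp (hγ : IsSmoothCurve γ a b) (φ : Lp ℂ 2 (volume : Measure ℝ)) :
    MemLp (fun τ => (inner ℂ (szegoLp τ) φ : ℂ)) 2 (arcLength γ a b) := by
  have := hγ.isFiniteMeasure
  obtain ⟨M, hM⟩ := hγ.exists_norm_szegoLp_le
  refine MemLp.of_bound (hγ.aestronglyMeasurable_szegoLp.inner aestronglyMeasurable_const)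
    (M * ‖φ‖) (hM.mono fun τ hτ => ?_)
  exact (norm_inner_le_norm _ _).trans (mul_le_mul_of_nonneg_right hτ (norm_nonneg _))

end IsSmoothCurve

/-! ### Restriction, its adjoint, and the factorisation of 𝒦 -/

/-- The restriction to the curve of the Cauchy integral of `φ`. -/
def restr (hγ : IsSmoothCurve γ a b) (φ : Lp ℂ 2 (volume : Measure ℝ)) : L2Curve γ a b :=
  (hγ.memLp_inner_szegoLp φ).toLp

/-- The adjoint of the restriction. -/
def synth (u : L2Curve γ a b) : Lp ℂ 2 (volume : Measure ℝ) :=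
  ∫ τ, u τ • szegoLp τ ∂(arcLength γ a b)

variable (hγ : IsSmoothCurve γ a b)

include hγ

lemma integrable_smul_szegoLp (u : L2Curve γ a b) :
    Integrable (fun τ => u τ • szegoLp τ) (arcLength γ a b) := by
  have := hγ.isFiniteMeasure
  obtain ⟨M, hM⟩ := hγ.exists_norm_szegoLp_le
  have hu : Integrable u (arcLength γ a b) := (Lp.memLp u).integrable one_le_two
  refine (hu.norm.mul_const M).mono' (hu.1.smul hγ.aestronglyMeasurable_szegoLp)
    (hM.mono fun τ hτ => ?_)
  rw [norm_smul]
  gcongr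

lemma inner_synth (u : L2Curve γ a b) (φ : Lp ℂ 2 (volume : Measure ℝ)) :
    inner ℂ φ (synth u) = ∫ τ, u τ * inner ℂ φ (szegoLp τ) ∂(arcLength γ a b) := by
  rw [synth, ← integral_inner (integrable_smul_szegoLp hγ u)]
  simp only [inner_smul_right]

lemma inner_restr (u : L2Curve γ a b) (φ : Lp ℂ 2 (volume : Measure ℝ)) :
    inner ℂ u (restr hγ φ) = inner ℂ (synth u) φ := by
  rw [← inner_conj_symm (synth u), inner_synth hγ, ← integral_conj, L2.inner_def]
  refine integral_congr_ae ?_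
  filter_upwards [(hγ.memLp_inner_szegoLp φ).coeFn_toLp] with τ hτ
  rw [restr, hτ, map_mul, inner_conj_symm, mul_comm]
  rfl

/-- A closed subspace is its own double orthogonal complement, and any `ψ` orthogonal to it is
orthogonal to each kernel in the integral, hence to the integral. -/
lemma synth_mem_hardySpace (u : L2Curve γ a b) : synth u ∈ hardySpace := by
  have : CompleteSpace hardySpace := isClosed_hardySpace.completeSpace_coe
  rw [← hardySpace.orthogonal_orthogonal, Submodule.mem_orthogonal]
  intro ψ hψ
  rw [inner_synth hγ]
  refine integral_eq_zero_of_ae ?_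
  filter_upwards [hγ.ae_im_pos] with τ hτ
  rw [hardySpace.inner_left_of_mem_orthogonal (szegoLp_mem_hardySpace hτ) hψ, mul_zero]
  rfl

/-- The factorisation 𝒦 = R R*, read off from the inner products of Szegő kernels. -/
lemma restr_synth_ae_eq (u : L2Curve γ a b) :
    restr hγ (synth u) =ᵐ[arcLength γ a b] curveOp γ a b u := by
  filter_upwards [(hγ.memLp_inner_szegoLp (synth u)).coeFn_toLp, hγ.ae_im_pos] with ζ hζ hpos
  rw [restr, hζ, inner_synth hγ, curveOp, ← integral_const_mul]
  refine integral_congr_ae ?_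
  filter_upwards [hγ.ae_im_pos] with τ hτ
  rw [inner_szegoLp hpos hτ, szego, ← div_div]
  ring

lemma restr_ae_eq {F : ℂ → ℂ} (hF : MemHardy F) {φ : Lp ℂ 2 (volume : Measure ℝ)}
    (hφ : Tendsto (sliceLp F) (𝓝[>] 0) (𝓝 φ)) : restr hγ φ =ᵐ[arcLength γ a b] F := by
  filter_upwards [(hγ.memLp_inner_szegoLp φ).coeFn_toLp, hγ.ae_im_pos] with ζ hζ hpos
  rw [restr, hζ, hF.eq_inner hφ hpos]

lemma restr_injOn : Set.InjOn (restr hγ) hardySpace := by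
  rintro φ ⟨F, hF, hφ⟩ ψ ⟨G, hG, hψ⟩ h
  have hae : F =ᵐ[arcLength γ a b] G :=
    (restr_ae_eq hγ hF hφ).symm.trans (h ▸ restr_ae_eq hγ hG hψ)
  have heq := hγ.eqOn_of_ae_eq hF.1 hG.1 hae
  refine tendsto_nhds_unique hφ (hψ.congr' ?_)
  filter_upwards [self_mem_nhdsWithin] with y hy
  have hy : 0 < y := hy
  rw [hF.sliceLp_eq hy, hG.sliceLp_eq hy]
  congr 1
  exact funext fun x => (heq (by simpa using hy)).symm

lemma restr_eq_of_isHardyExtension {F : ℂ → ℂ} {f : L2Curve γ a b} (hF : IsHardyExtension F f)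
    {φ : Lp ℂ 2 (volume : Measure ℝ)} (hφ : Tendsto (sliceLp F) (𝓝[>] 0) (𝓝 φ)) :
    restr hγ φ = f :=
  Lp.ext ((restr_ae_eq hγ hF.1 hφ).trans hF.2)

variable {e : HilbertBasis ℕ ℂ (L2Curve γ a b)} {lam : ℕ → ℝ} (he : IsEigenbasis e lam)

include he

lemma restr_synth_eigen (n : ℕ) : restr hγ (synth (e n)) = (lam n : ℂ) • e n := by
  refine Lp.ext (((restr_synth_ae_eq hγ (e n)).trans (he n)).trans ?_)
  filter_upwards [Lp.coeFn_smul (lam n : ℂ) (e n)] with ζ hζ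
  rw [hζ]
  rfl

/-- ⟪R* e_n, R* e_n⟫ = ⟪e_n, 𝒦 e_n⟫. In particular the eigenvalues are nonnegative, which is not
assumed. -/
lemma inner_synth_self (n : ℕ) : inner ℂ (synth (e n)) (synth (e n)) = (lam n : ℂ) := by
  rw [← inner_restr hγ, restr_synth_eigen hγ he, inner_smul_right, inner_self_eq_norm_sq_complex,
    e.orthonormal.1]
  simp

lemma inner_synth_of_ne : Pairwise fun m n => inner ℂ (synth (e m)) (synth (e n)) = 0 :=
  fun m n hmn => by
    beta_reduce
    rw [← inner_restr hγ, restr_synth_eigen hγ he, inner_smul_right, e.orthonormal.2 hmn, mul_zero]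

/-- By adjointness the coefficients of the restriction are ⟪R* e_n, φ⟫, so this is Bessel's
inequality. -/
lemma restr_mem_HPlus (φ : Lp ℂ 2 (volume : Measure ℝ)) : restr hγ φ ∈ HPlus e lam := by
  have h := tsum_enorm_sq_div_lt_top (inner_synth_self hγ he) (inner_synth_of_ne hγ he) φ
  simpa only [HPlus, Set.mem_ofPred_eq, coeff, inner_restr hγ] using h

/-- Every element of `H₊` is the restriction of a Hardy function with an explicit expansion. -/
lemma exists_hasSum_of_mem_HPlus {f : L2Curve γ a b} (hf : f ∈ HPlus e lam) :
    ∃ φ ∈ hardySpace, HasSum (fun n => (coeff e f n / lam n) • synth (e n)) φ ∧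
      restr hγ φ = f := by
  have hf' : ∑' n, ‖coeff e f n‖ₑ ^ 2 / ENNReal.ofReal (lam n) < ∞ := hf
  obtain ⟨φ, hφ⟩ := summable_div_smul (inner_synth_self hγ he) (inner_synth_of_ne hγ he) hf'
  refine ⟨φ, ?_, hφ, ?_⟩
  · refine isClosed_hardySpace.mem_of_tendsto hφ (Eventually.of_forall fun s => ?_)
    exact hardySpace.sum_mem fun n _ => hardySpace.smul_mem _ (synth_mem_hardySpace hγ _)
  -- Both sides are compared through their coefficients in the basis `e`: pairing the series with
  -- `synth (e m)` leaves only the term `n = m`. If `lam m = 0`, that term is `0`, and membership in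
  -- H₊ forces the coefficient of `f` to be `0` as well.
  · refine e.repr.injective (lp.ext (funext fun m => ?_))
    rw [e.repr_apply_apply, e.repr_apply_apply, inner_restr hγ]
    have h1 := hφ.mapL (innerSL ℂ (synth (e m)))
    have h2 : HasSum (fun n => innerSL ℂ (synth (e m)) ((coeff e f n / lam n) • synth (e n)))
        (coeff e f m) := by
      have h3 := hasSum_single (f := fun n =>
        innerSL ℂ (synth (e m)) ((coeff e f n / lam n) • synth (e n))) m fun n hn => by
          rw [innerSL_apply_apply, inner_smul_right, inner_synth_of_ne hγ he hn.symm, mul_zero]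
      have h4 : innerSL ℂ (synth (e m)) ((coeff e f m / lam m) • synth (e m)) = coeff e f m := by
        rw [innerSL_apply_apply, inner_smul_right, inner_synth_self hγ he]
        by_cases hl : lam m = 0
        · rw [eq_zero_of_enorm_sq_div_lt_top ((ENNReal.le_tsum m).trans_lt hf') hl]
          simp
        · exact div_mul_cancel₀ _ (by exact_mod_cast hl)
      rwa [h4] at h3
    exact h1.unique h2

end Curve

end HardyCurve

end

theorem lemma4p3 (γ : ℝ → ℂ) (a b : ℝ) (hγ : HardyCurve.IsSmoothCurve γ a b)
    (e : HilbertBasis ℕ ℂ (HardyCurve.L2Curve γ a b)) (lam : ℕ → ℝ)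
    (he : HardyCurve.IsEigenbasis e lam) :
    (∀ f : HardyCurve.L2Curve γ a b,
      f ∈ HardyCurve.HPlus e lam ↔ ∃ F : ℂ → ℂ, HardyCurve.IsHardyExtension F f) ∧
    (∀ (f : HardyCurve.L2Curve γ a b) (F₁ F₂ : ℂ → ℂ),
      HardyCurve.IsHardyExtension F₁ f → HardyCurve.IsHardyExtension F₂ f →
        Set.EqOn F₁ F₂ {z : ℂ | 0 < z.im}) ∧
    (∀ F : ℂ → ℂ, HardyCurve.MemHardy F →
      ∃ f ∈ HardyCurve.HPlus e lam, HardyCurve.IsHardyExtension F f) ∧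
    (∀ f ∈ HardyCurve.HPlus e lam, ∀ g ∈ HardyCurve.HPlus e lam, ∀ F G : ℂ → ℂ,
      HardyCurve.IsHardyExtension F f → HardyCurve.IsHardyExtension G g →
        ∃ φ ψ : Lp ℂ 2 (volume : Measure ℝ),
          HardyCurve.IsBoundaryValue F φ ∧ HardyCurve.IsBoundaryValue G ψ ∧
          HasSum (fun n => HardyCurve.coeff e f n * conj (HardyCurve.coeff e g n) / (lam n : ℂ))
            (∫ x, φ x * conj (ψ x))) := by
  open HardyCurve in
  refine ⟨fun f => ⟨fun hf => ?_, ?_⟩, fun f F₁ F₂ h₁ h₂ => ?_, fun F hF => ?_, ?_⟩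
  · obtain ⟨φ, ⟨F, hF, hφ⟩, -, hr⟩ := exists_hasSum_of_mem_HPlus hγ he hf
    exact ⟨F, hF, hr ▸ (restr_ae_eq hγ hF hφ).symm⟩
  · rintro ⟨F, hF⟩
    obtain ⟨φ, hφ⟩ := hF.1.exists_tendsto_sliceLp
    exact restr_eq_of_isHardyExtension hγ hF hφ ▸ restr_mem_HPlus hγ he φ
  · exact hγ.eqOn_of_ae_eq h₁.1.1 h₂.1.1 (h₁.2.trans h₂.2.symm)
  · obtain ⟨φ, hφ⟩ := hF.exists_tendsto_sliceLp
    exact ⟨_, restr_mem_HPlus hγ he φ, hF, (restr_ae_eq hγ hF hφ).symm⟩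
  · intro f hf g hg F G hF hG
    obtain ⟨φ, hφ⟩ := hF.1.exists_tendsto_sliceLp
    obtain ⟨ψ, hψ⟩ := hG.1.exists_tendsto_sliceLp
    refine ⟨φ, ψ, hF.1.isBoundaryValue_iff.2 hφ, hG.1.isBoundaryValue_iff.2 hψ, ?_⟩
    -- The sum `φ'` of the series and the boundary value `φ` of the given `F` are both in the Hardy
    -- space and both restrict to `f`, so injectivity transfers the expansion to `φ`.
    obtain ⟨φ', hφ'mem, hsum, hr⟩ := exists_hasSum_of_mem_HPlus hγ he hf
    have hφφ' : φ' = φ := restr_injOn hγ hφ'mem ⟨F, hF.1, hφ⟩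
      (hr.trans (restr_eq_of_isHardyExtension hγ hF hφ).symm)
    rw [hφφ'] at hsum
    have h := hsum.mapL (innerSL ℂ ψ)
    have hin : innerSL ℂ ψ φ = ∫ x, φ x * conj (ψ x) := by
      rw [innerSL_apply_apply, L2.inner_def]
      rfl
    rw [hin] at h
    -- By adjointness `⟪ψ, synth (e n)⟫` is the conjugate of the `n`-th coefficient of `restr hγ ψ =
    -- g`.
    refine h.congr_fun fun n => ?_
    rw [innerSL_apply_apply, inner_smul_right, ← inner_conj_symm ψ, ← inner_restr hγ,
      restr_eq_of_isHardyExtension hγ hG hψ, coeff, coeff]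
    ring
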